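/- Let $D\subset\mathbb{C}^n$ be a bounded logarithmically convex complete Reinhardt domain centered at the origin, and let $\mu$ be a weight, i.e. a positive function on $\{|z|=(|z_1|,\dots,|z_n|) : z\in D\}$ such that $z\mapsto\mu(|z|)$ is measurable and $\int_D\mu(|z|)\,dv(z)<\infty$, where $dv$ is Lebesgue measure. Let $K_D$ be the Bergman kernel of $D$ with weight $\mu$, i.e. the reproducing kernel of the space $\mathcal{A}^2_\mu(D)$ of holomorphic functions $f$ on $D$ with $\int_D|f(z)|^2\mu(|z|)\,dv(z)<\infty$ (for $\mu\equiv 1$ it is the classical Bergman kernel of $D$). Let $$ds^2_D=\sum_{k,l=1}^n\frac{\partial^2\log K_D(z,z)}{\partial z_k\,\partial\bar z_l}\,dz_k\otimes d\bar z_l$$ be the Bergman metric, $h_D=\operatorname{Re}(ds^2_D)$ the associated Riemannian metric, and $$\widehat D=\{z\in D : z_k\neq 0 \text{ for every } k=1,\dots,n\}.$$ The torus $\mathbb{T}^n$ acts on $\widehat D$ by $(t,z)\mapsto(t_1z_1,\dots,t_nz_n)$. Let $\gamma:I\to\widehat D$, with $I\subset\mathbb{R}$ an open interval, be a geodesic of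 $h_D$. If at some time $t_0\in I$ the velocity $\gamma'(t_0)$ is $h_D$-perpendicular to the $\mathbb{T}^n$-orbit through $\gamma(t_0)$, then $\gamma$ intersects perpendicularly every $\mathbb{T}^n$-orbit that it meets: for every $\mathbb{T}^n$-orbit $\mathcal{O}$ in $\widehat D$ and every $t\in I$ with $\gamma(t)\in\mathcal{O}$, the velocity $\gamma'(t)$ is $h_D$-perpendicular to $T_{\gamma(t)}\mathcal{O}$. -/

import Mathlib

open MeasureTheory Set

noncomputable section

/-- The moduli `|z| = (|z_1|, …, |z_n|)` of a point of `ℂⁿ`. -/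
def moduli {n : ℕ} (z : Fin n → ℂ) : Fin n → ℝ := fun k => ‖z k‖

/-- `D` is a bounded logarithmically convex complete Reinhardt domain in `ℂⁿ` centered at the
origin. -/
structure IsBoundedLogConvexCompleteReinhardt {n : ℕ} (D : Set (Fin n → ℂ)) : Prop where
  isOpen : IsOpen D
  isConnected : IsConnected D
  isBounded : Bornology.IsBounded D
  complete : ∀ z ∈ D, ∀ w : Fin n → ℂ, (∀ k, ‖w k‖ ≤ ‖z k‖) → w ∈ D
  logConvex : Convex ℝ ((fun (z : Fin n → ℂ) (k : Fin n) => Real.log ‖z k‖) ''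
    {z | z ∈ D ∧ ∀ k, z k ≠ 0})

/-- `μ` is a weight for `D`: it is positive on the base `τ(D) = {|z| : z ∈ D}`, and `μ(|z|)` is
(measurable and) integrable over `D` with respect to Lebesgue measure. -/
structure IsReinhardtWeight {n : ℕ} (D : Set (Fin n → ℂ)) (μ : (Fin n → ℝ) → ℝ) : Prop where
  pos : ∀ z ∈ D, 0 < μ (moduli z)
  integrable : IntegrableOn (fun z => μ (moduli z)) D volume

/-- Membership in the weighted Bergman space `A²_μ(D)`: `f` is holomorphic on `D` and
`∫_D |f(z)|² μ(|z|) dv(z) < ∞`. (Values of `f` outside `D` are irrelevant.) -/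
def MemBergman {n : ℕ} (D : Set (Fin n → ℂ)) (μ : (Fin n → ℝ) → ℝ) (f : (Fin n → ℂ) → ℂ) :
    Prop :=
  DifferentiableOn ℂ f D ∧ IntegrableOn (fun z => ‖f z‖ ^ 2 * μ (moduli z)) D volume

/-- `K` is the reproducing kernel of `A²_μ(D)`: for every `ζ ∈ D`, `K(·, ζ) ∈ A²_μ(D)` and
`f(ζ) = ⟨f, K(·, ζ)⟩` for every `f ∈ A²_μ(D)`. This determines `K` on `D × D`. -/
def IsBergmanKernel {n : ℕ} (D : Set (Fin n → ℂ)) (μ : (Fin n → ℝ) → ℝ)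
    (K : (Fin n → ℂ) → (Fin n → ℂ) → ℂ) : Prop :=
  ∀ ζ ∈ D, MemBergman D μ (fun z => K z ζ) ∧
    ∀ f, MemBergman D μ f →
      f ζ = ∫ z in D, f z * (starRingEnd ℂ) (K z ζ) * (μ (moduli z) : ℂ)

open Classical in
/-- The Bergman kernel of `D` with weight `μ`; for `μ = 1` it is the classical Bergman kernel
`K_D(z, ζ)`. -/
def bergmanKernel {n : ℕ} (D : Set (Fin n → ℂ)) (μ : (Fin n → ℝ) → ℝ) :
    (Fin n → ℂ) → (Fin n → ℂ) → ℂ :=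
  if h : ∃ K, IsBergmanKernel D μ K then h.choose else fun _ _ => 0

/-- The Wirtinger derivative `∂F/∂z_k = ½ (∂F/∂x_k - i ∂F/∂y_k)`. -/
def wirtinger {n : ℕ} (k : Fin n) (F : (Fin n → ℂ) → ℂ) (z : Fin n → ℂ) : ℂ :=
  (1 / 2 : ℂ) * (fderiv ℝ F z (Pi.single k 1) - Complex.I * fderiv ℝ F z (Pi.single k Complex.I))

/-- The Wirtinger derivative `∂F/∂z̄_k = ½ (∂F/∂x_k + i ∂F/∂y_k)`. -/
def wirtingerBar {n : ℕ} (k : Fin n) (F : (Fin n → ℂ) → ℂ) (z : Fin n → ℂ) : ℂ :=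
  (1 / 2 : ℂ) * (fderiv ℝ F z (Pi.single k 1) + Complex.I * fderiv ℝ F z (Pi.single k Complex.I))

/-- `log K_D(z, z)`, as a complex-valued function. (`K_D(z, z)` is real and positive on `D`.) -/
def logBergmanDiag {n : ℕ} (D : Set (Fin n → ℂ)) (μ : (Fin n → ℝ) → ℝ) (z : Fin n → ℂ) : ℂ :=
  (Real.log (bergmanKernel D μ z z).re : ℂ)

/-- The Hermitian Bergman metric
`ds² = ∑_{k,l} (∂² log K_D(z,z) / ∂z_k ∂z̄_l) dz_k ⊗ dz̄_l`. -/
def bergmanHermitian {n : ℕ} (D : Set (Fin n → ℂ)) (μ : (Fin n → ℝ) → ℝ)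
    (z u v : Fin n → ℂ) : ℂ :=
  ∑ k, ∑ l, wirtinger k (wirtingerBar l (logBergmanDiag D μ)) z * u k * (starRingEnd ℂ) (v l)

/-- The associated Riemannian metric `h_D = Re ds²`. -/
def bergmanRiemannian {n : ℕ} (D : Set (Fin n → ℂ)) (μ : (Fin n → ℝ) → ℝ)
    (z u v : Fin n → ℂ) : ℝ :=
  (bergmanHermitian D μ z u v).re

/-- The Christoffel symbols of the first kind of a metric `h` on an open set of a real vector
space `E`, as a trilinear form: `½ (∂_u h(v,w) + ∂_v h(u,w) - ∂_w h(u,v))` at `p`. By the Koszul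
formula it is `h(∇_u v, w)` for constant vector fields `u`, `v`, `w`, where `∇` is the
Levi-Civita connection. -/
def christoffelForm {E : Type*} [NormedAddCommGroup E] [NormedSpace ℝ E]
    (h : E → E → E → ℝ) (p u v w : E) : ℝ :=
  (1 / 2 : ℝ) * (fderiv ℝ (fun q => h q v w) p u + fderiv ℝ (fun q => h q u w) p v
    - fderiv ℝ (fun q => h q u v) p w)

/-- `γ`, restricted to the open interval `I`, is a geodesic of the metric `h` on the open set `U`:
it is a `C²` curve in `U` with `∇_{γ'} γ' = 0`. The geodesic equation is written in its
equivalent form with lowered index, `h(γ'', w) + h(Γ(γ', γ'), w) = 0` for every vector `w`. -/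
structure IsGeodesicOn {E : Type*} [NormedAddCommGroup E] [NormedSpace ℝ E]
    (h : E → E → E → ℝ) (U : Set E) (γ : ℝ → E) (I : Set ℝ) : Prop where
  isOpen : IsOpen I
  ordConnected : I.OrdConnected
  contDiffOn : ContDiffOn ℝ 2 γ I
  mapsTo : MapsTo γ I U
  geodesicEq : ∀ t ∈ I, ∀ w : E,
    h (γ t) (deriv (deriv γ) t) w + christoffelForm h (γ t) (deriv γ t) (deriv γ t) w = 0

/-- The points of `D` all of whose coordinates are nonzero. -/
def hatDomain {n : ℕ} (D : Set (Fin n → ℂ)) : Set (Fin n → ℂ) := {z | z ∈ D ∧ ∀ k, z k ≠ 0}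

/-- The orbit of `z` under the action `(t, z) ↦ (t_1 z_1, …, t_n z_n)` of the torus `𝕋ⁿ`. -/
def torusOrbit {n : ℕ} (z : Fin n → ℂ) : Set (Fin n → ℂ) :=
  {w | ∃ t : Fin n → Circle, w = fun k => (t k : ℂ) * z k}

/-- The vectors tangent at `p` to a submanifold `S`: velocities of curves in `S` through `p`. -/
def tangentVectorsAt {E : Type*} [NormedAddCommGroup E] [NormedSpace ℝ E]
    (S : Set E) (p : E) : Set E :=
  {v | ∃ c : ℝ → E, (∀ s, c s ∈ S) ∧ c 0 = p ∧ HasDerivAt c v 0}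

/-- The curve `γ` meets `S` at time `t`, perpendicularly with respect to the metric `h`. -/
def MeetsPerpendicularlyAt {E : Type*} [NormedAddCommGroup E] [NormedSpace ℝ E]
    (h : E → E → E → ℝ) (γ : ℝ → E) (S : Set E) (t : ℝ) : Prop :=
  γ t ∈ S ∧ ∀ v ∈ tangentVectorsAt S (γ t), h (γ t) (deriv γ t) v = 0

end

/-!
The proof is a conservation law. For `θ ∈ ℝⁿ` the linear field `A_θ(z) = (iθ_1 z_1, …, iθ_n z_n)`
generates a one-parameter group of torus rotations. These preserve `D` and the measure
`μ(|z|) dv(z)`, hence the Bergman kernel (`IsBergmanKernel.comp_torusRotation`) and the Bergman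
metric `h_D`, so `A_θ` is a Killing field. By Noether's theorem
(`IsGeodesicOn.hasDerivAt_killing`) the function `h_D(γ', A_θ(γ))` is constant along a geodesic `γ`.
Where no coordinate vanishes, the values of the fields `A_θ` are exactly the vectors tangent to the
torus orbit (`torusField_mem_tangentVectorsAt`, `exists_eq_torusField`). Perpendicularity at one time
therefore says that all these constants vanish, and perpendicularity at any other time follows.

Differentiating the metric along `γ` requires `log K_D(z, z)` to be smooth. This rests on a Cauchy
formula integrated over volumes: if a closed polyannulus `B = {r_k ≤ |w_k| ≤ R_k}` lies in `D`, then
`∫_B f(w) ∏ w_k / (w_k - ζ_k) μ(|w|) dv(w)` is a constant times `f(ζ)` for `|ζ_k| < r_k`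
(`setIntegral_mul_cauchyKernel`). So evaluation at `ζ` is given on `A²_μ(D)` by pairing with an
explicit vector of `L²` that depends smoothly on `ζ` (`exists_evaluation_vectors`). It follows that
`A²_μ(D)` is closed in `L²`, that the kernel function `K_D(·, ζ)` exists, being the orthogonal
projection of that vector to `A²_μ(D)`, and that `K_D(ζ, ζ)`, its squared norm, is smooth. It is
positive because constants belong to `A²_μ(D)`.

As `log K_D(z, z)` is real, `h_D` is the Hermitian part `¼ (H(u, v) + H(iu, iv))` of its real Hessian
`H` (`bergmanRiemannian_eq_hermitianHessian`); symmetry and torus invariance of `h_D` are read off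
from this form.
-/

noncomputable section

/-! ### The torus action and the weighted measure -/

/-- The action `z ↦ (t_1 z_1, …, t_n z_n)` of `t ∈ 𝕋ⁿ` on `ℂⁿ`, as a real-linear equivalence. -/
def torusRotation {n : ℕ} (t : Fin n → Circle) : (Fin n → ℂ) ≃L[ℝ] (Fin n → ℂ) :=
  ContinuousLinearEquiv.piCongrRight fun k => (rotation (t k)).toContinuousLinearEquiv

@[simp] lemma torusRotation_apply {n : ℕ} (t : Fin n → Circle) (z : Fin n → ℂ) (k : Fin n) :
    torusRotation t z k = (t k : ℂ) * z k := by
  simp [torusRotation, rotation_apply]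

lemma norm_torusRotation_apply {n : ℕ} (t : Fin n → Circle) (z : Fin n → ℂ) (k : Fin n) :
    ‖torusRotation t z k‖ = ‖z k‖ := by
  rw [torusRotation_apply, norm_mul, Circle.norm_coe, one_mul]

lemma moduli_torusRotation {n : ℕ} (t : Fin n → Circle) (z : Fin n → ℂ) :
    moduli (torusRotation t z) = moduli z := by
  ext k
  exact norm_torusRotation_apply t z k

lemma measurePreserving_torusRotation {n : ℕ} (t : Fin n → Circle) :
    MeasurePreserving (torusRotation t) volume volume :=
  volume_preserving_pi fun k => (rotation (t k)).measurePreserving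

lemma differentiable_torusRotation {n : ℕ} (t : Fin n → Circle) :
    Differentiable ℂ (torusRotation t) := by
  have : (torusRotation t : (Fin n → ℂ) → Fin n → ℂ) = fun z k => (t k : ℂ) * z k := by
    ext z k
    simp
  rw [this]
  fun_prop

namespace IsBoundedLogConvexCompleteReinhardt

variable {n : ℕ} {D : Set (Fin n → ℂ)}

lemma torusRotation_mem_iff (hD : IsBoundedLogConvexCompleteReinhardt D) (t : Fin n → Circle)
    (z : Fin n → ℂ) : torusRotation t z ∈ D ↔ z ∈ D :=
  ⟨fun h => hD.complete _ h _ fun k => (norm_torusRotation_apply t z k).ge,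
    fun h => hD.complete _ h _ fun k => (norm_torusRotation_apply t z k).le⟩

lemma preimage_torusRotation (hD : IsBoundedLogConvexCompleteReinhardt D) (t : Fin n → Circle) :
    torusRotation t ⁻¹' D = D :=
  Set.ext fun z => hD.torusRotation_mem_iff t z

end IsBoundedLogConvexCompleteReinhardt

/-- The measure `μ(|z|) dv(z)` on `D`, extended by zero to `ℂⁿ`. -/
def bergmanMeasure {n : ℕ} (D : Set (Fin n → ℂ)) (μ : (Fin n → ℝ) → ℝ) :
    Measure (Fin n → ℂ) :=
  (volume.restrict D).withDensity fun z => ENNReal.ofReal (μ (moduli z))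

section BergmanMeasure

variable {n : ℕ} {D : Set (Fin n → ℂ)} {μ : (Fin n → ℝ) → ℝ}

lemma bergmanMeasure_absolutelyContinuous :
    bergmanMeasure D μ ≪ volume.restrict D :=
  withDensity_absolutelyContinuous _ _

lemma ae_mem_bergmanMeasure (hD : IsOpen D) : ∀ᵐ z ∂bergmanMeasure D μ, z ∈ D :=
  bergmanMeasure_absolutelyContinuous.ae_le (ae_restrict_mem hD.measurableSet)

lemma IsReinhardtWeight.aemeasurable (hμ : IsReinhardtWeight D μ) :
    AEMeasurable (fun z => ENNReal.ofReal (μ (moduli z))) (volume.restrict D) :=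
  hμ.integrable.1.aemeasurable.ennreal_ofReal

lemma isFiniteMeasure_bergmanMeasure (hμ : IsReinhardtWeight D μ) :
    IsFiniteMeasure (bergmanMeasure D μ) :=
  isFiniteMeasure_withDensity_ofReal hμ.integrable.2

lemma integral_bergmanMeasure (hD : IsOpen D) (hμ : IsReinhardtWeight D μ)
    (f : (Fin n → ℂ) → ℂ) :
    ∫ z, f z ∂bergmanMeasure D μ = ∫ z in D, f z * (μ (moduli z) : ℂ) := by
  rw [bergmanMeasure, integral_withDensity_eq_integral_toReal_smul₀ hμ.aemeasurable
    (Filter.Eventually.of_forall fun _ => ENNReal.ofReal_lt_top)]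
  refine setIntegral_congr_fun hD.measurableSet fun z hz => ?_
  simp only [ENNReal.toReal_ofReal (hμ.pos z hz).le, Complex.real_smul]
  ring

lemma integrable_bergmanMeasure_iff (hD : IsOpen D) (hμ : IsReinhardtWeight D μ)
    (f : (Fin n → ℂ) → ℝ) :
    Integrable f (bergmanMeasure D μ) ↔ IntegrableOn (fun z => f z * μ (moduli z)) D := by
  rw [bergmanMeasure, integrable_withDensity_iff_integrable_smul₀' hμ.aemeasurable
    (Filter.Eventually.of_forall fun _ => ENNReal.ofReal_lt_top)]
  refine integrableOn_congr_fun (fun z hz => ?_) hD.measurableSet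
  simp only [ENNReal.toReal_ofReal (hμ.pos z hz).le, smul_eq_mul]
  ring

lemma aestronglyMeasurable_of_differentiableOn (hD : IsOpen D) {f : (Fin n → ℂ) → ℂ}
    (hf : DifferentiableOn ℂ f D) : AEStronglyMeasurable f (bergmanMeasure D μ) :=
  (hf.continuousOn.aestronglyMeasurable hD.measurableSet).mono_ac
    bergmanMeasure_absolutelyContinuous

lemma memBergman_iff (hD : IsOpen D) (hμ : IsReinhardtWeight D μ) (f : (Fin n → ℂ) → ℂ) :
    MemBergman D μ f ↔ DifferentiableOn ℂ f D ∧ MemLp f 2 (bergmanMeasure D μ) := by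
  refine and_congr_right fun hf => ?_
  rw [memLp_two_iff_integrable_sq_norm (aestronglyMeasurable_of_differentiableOn hD hf),
    integrable_bergmanMeasure_iff hD hμ]

lemma bergmanMeasure_ne_zero_of_isOpen (hμ : IsReinhardtWeight D μ)
    {U : Set (Fin n → ℂ)} (hU : IsOpen U) (hUD : U ⊆ D) (hne : U.Nonempty) :
    bergmanMeasure D μ U ≠ 0 := by
  intro h0
  rw [bergmanMeasure, withDensity_apply _ hU.measurableSet, lintegral_eq_zero_iff'
    (hμ.aemeasurable.mono_measure Measure.restrict_le_self),
    Measure.restrict_restrict hU.measurableSet, inter_eq_left.2 hUD] at h0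
  have h1 : ∀ᵐ z ∂volume.restrict U, False := by
    filter_upwards [h0, ae_restrict_mem hU.measurableSet] with z hz hzU
    simp only [Pi.zero_apply, ENNReal.ofReal_eq_zero] at hz
    exact (hμ.pos z (hUD hzU)).not_ge hz
  rw [Filter.eventually_false_iff_eq_bot, ae_eq_bot, Measure.restrict_eq_zero] at h1
  exact (hU.measure_pos volume hne).ne' h1

lemma measurePreserving_torusRotation_bergmanMeasure
    (hD : IsBoundedLogConvexCompleteReinhardt D) (t : Fin n → Circle) :
    MeasurePreserving (torusRotation t) (bergmanMeasure D μ) (bergmanMeasure D μ) := by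
  have he : MeasurableEmbedding (torusRotation t) :=
    (torusRotation t).toHomeomorph.measurableEmbedding
  refine ⟨he.measurable, Measure.ext fun s hs => ?_⟩
  rw [Measure.map_apply he.measurable hs, bergmanMeasure,
    withDensity_apply _ (he.measurable hs), withDensity_apply _ hs,
    Measure.restrict_restrict (he.measurable hs), Measure.restrict_restrict hs,
    ← (measurePreserving_torusRotation t).setLIntegral_comp_preimage_emb he _ (s ∩ D),
    preimage_inter, hD.preimage_torusRotation]
  simp only [moduli_torusRotation]

end BergmanMeasure

/-! ### A Cauchy formula for the weighted volume of polyannuli -/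

/-- The closed polyannulus `{w : r_k ≤ |w_k| ≤ R_k}`. -/
def polyannulus {n : ℕ} (r R : Fin n → ℝ) : Set (Fin n → ℂ) :=
  {w | ∀ k, r k ≤ ‖w k‖ ∧ ‖w k‖ ≤ R k}

section Cauchy

variable {n : ℕ} {D : Set (Fin n → ℂ)} {μ : (Fin n → ℝ) → ℝ} {r R : Fin n → ℝ}

lemma isCompact_polyannulus (r R : Fin n → ℝ) : IsCompact (polyannulus r R) := by
  have h : polyannulus r R = univ.pi fun k => Metric.closedBall (0 : ℂ) (R k) ∩ {x | r k ≤ ‖x‖} := by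
    ext w
    simp [polyannulus, mem_pi, and_comm]
  rw [h]
  exact isCompact_univ_pi fun k => (isCompact_closedBall 0 (R k)).inter_right
    (isClosed_le continuous_const continuous_norm)

lemma preimage_torusRotation_polyannulus (t : Fin n → Circle) :
    torusRotation t ⁻¹' polyannulus r R = polyannulus r R := by
  ext w
  simp only [mem_preimage, polyannulus, mem_ofPred_eq, norm_torusRotation_apply]

/-- The partial Cauchy kernel: the variables in `S` have been integrated out, so that `f` is
evaluated at `ζ_k` for `k ∈ S`, and the Cauchy factors of the other variables remain. -/
def partialCauchy (f : (Fin n → ℂ) → ℂ) (ζ : Fin n → ℂ) (S : Finset (Fin n)) (w : Fin n → ℂ) : ℂ :=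
  f (S.piecewise ζ w) * ∏ k ∈ Sᶜ, w k / (w k - ζ k)

lemma continuousOn_partialCauchy (hD : IsBoundedLogConvexCompleteReinhardt D)
    (hB : polyannulus r R ⊆ D) {f : (Fin n → ℂ) → ℂ} (hf : ContinuousOn f D) {ζ : Fin n → ℂ}
    (hζ : ∀ k, ‖ζ k‖ < r k) (S : Finset (Fin n)) :
    ContinuousOn (partialCauchy f ζ S) (polyannulus r R) := by
  refine ContinuousOn.mul (hf.comp ?_ fun w hw => hD.complete w (hB hw) _ fun k => ?_) ?_
  · refine continuousOn_pi.2 fun k => ?_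
    by_cases hk : k ∈ S
    · simp [Finset.piecewise, hk, continuousOn_const]
    · simpa [Finset.piecewise, hk] using (continuous_apply k).continuousOn
  · by_cases hk : k ∈ S
    · simpa [hk] using (hζ k).le.trans (hw k).1
    · simp [hk]
  · refine continuousOn_finsetProd _ fun k _ => ContinuousOn.div (by fun_prop) (by fun_prop) ?_
    intro w hw h0
    exact ((hζ k).trans_le (sub_eq_zero.1 h0 ▸ (hw k).1)).false

/-- The one-variable Cauchy formula, as a circle average in the `k`-th variable. -/
lemma circleAverage_partialCauchy (hD : IsBoundedLogConvexCompleteReinhardt D)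
    (hB : polyannulus r R ⊆ D) {f : (Fin n → ℂ) → ℂ} (hf : DifferentiableOn ℂ f D)
    {ζ : Fin n → ℂ} (hζ : ∀ k, ‖ζ k‖ < r k) {S : Finset (Fin n)} {k : Fin n} (hk : k ∉ S)
    {w : Fin n → ℂ} (hw : w ∈ polyannulus r R) :
    Real.circleAverage (fun x => partialCauchy f ζ S (Function.update w k (x * w k))) 0 1 =
      partialCauchy f ζ (insert k S) w := by
  have hwk : w k ≠ 0 := norm_pos_iff.1 (((norm_nonneg _).trans_lt (hζ k)).trans_le (hw k).1)
  set p : Fin n → ℂ := S.piecewise ζ w with hp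
  have hpw : ∀ j, ‖p j‖ ≤ ‖w j‖ := fun j => by
    by_cases hj : j ∈ S
    · simpa [hp, hj] using (hζ j).le.trans (hw j).1
    · simp [hp, hj]
  set g : ℂ → ℂ := fun x => f (Function.update p k (x * w k)) with hg
  have hgd : DifferentiableOn ℂ g (Metric.closedBall 0 1) := by
    refine hf.comp (fun x _ => DifferentiableAt.differentiableWithinAt ?_) fun x hx => ?_
    · refine differentiableAt_pi.2 fun j => ?_
      by_cases hj : j = k
      · subst hj
        simp
      · simp [hj]
    · refine hD.complete w (hB hw) _ fun j => ?_
      by_cases hj : j = k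
      · subst hj
        simpa using mul_le_of_le_one_left (norm_nonneg _) (by simpa using hx)
      · simpa [hj] using hpw j
  have hζw : ζ k / w k ∈ Metric.ball (0 : ℂ) |1| := by
    simpa [div_lt_one (norm_pos_iff.2 hwk)] using (hζ k).trans_le (hw k).1
  -- After rescaling the variable by `w k` the circle becomes the unit circle, and the Cauchy factor
  -- becomes the kernel `x / (x - ζ k / w k)` of the generalized mean value property.
  have hmain := DiffContOnCl.circleAverage_smul_div (c := 0) (R := 1) (w := ζ k / w k) (f := g)
    (by simpa using hgd.diffContOnCl_ball Subset.rfl) hζw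
  have hrest : ∀ x : ℂ, partialCauchy f ζ S (Function.update w k (x * w k)) =
      (∏ j ∈ (insert k S)ᶜ, w j / (w j - ζ j)) • ((x - 0) / (x - ζ k / w k)) • g x := by
    intro x
    have h1 : Sᶜ = insert k (insert k S)ᶜ := by
      ext j
      by_cases hj : j = k <;> simp [hj, hk]
    have h2 : (x - 0) / (x - ζ k / w k) = x * w k / (x * w k - ζ k) := by
      rw [sub_zero, ← mul_div_mul_right _ _ hwk, sub_mul, div_mul_cancel₀ _ hwk]
    have h3 : S.piecewise ζ (Function.update w k (x * w k)) = Function.update p k (x * w k) := by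
      ext j
      by_cases hj : j = k
      · subst hj; simp [hk]
      · by_cases hjS : j ∈ S <;> simp [hj, hjS, hp]
    rw [partialCauchy, h1, Finset.prod_insert (by simp), h2, h3, smul_eq_mul, smul_eq_mul,
      Function.update_self]
    have h4 : ∏ j ∈ (insert k S)ᶜ, Function.update w k (x * w k) j /
        (Function.update w k (x * w k) j - ζ j) = ∏ j ∈ (insert k S)ᶜ, w j / (w j - ζ j) := by
      refine Finset.prod_congr rfl fun j hj => ?_
      have : j ≠ k := by
        rintro rfl
        simp at hj
      simp [this]
    rw [h4]
    ring
  simp only [hrest]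
  rw [Real.circleAverage_fun_smul, hmain, partialCauchy, smul_eq_mul, mul_comm, hg]
  refine congrArg (· * _) (congrArg f (funext fun j => ?_))
  by_cases hj : j = k
  · subst hj; simp [hwk]
  · by_cases hjS : j ∈ S <;> simp [hj, hjS, hp]

/-- Integrating over the polyannulus integrates out one more variable: the integral is unchanged
by rotations of that variable, hence equal to its average over all rotations. -/
lemma setIntegral_partialCauchy_insert (hD : IsBoundedLogConvexCompleteReinhardt D)
    (hμ : IsReinhardtWeight D μ)
    (hB : polyannulus r R ⊆ D) {f : (Fin n → ℂ) → ℂ} (hf : DifferentiableOn ℂ f D)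
    {ζ : Fin n → ℂ} (hζ : ∀ k, ‖ζ k‖ < r k) {S : Finset (Fin n)} {k : Fin n} (hk : k ∉ S) :
    ∫ w in polyannulus r R, partialCauchy f ζ S w ∂bergmanMeasure D μ =
      ∫ w in polyannulus r R, partialCauchy f ζ (insert k S) w ∂bergmanMeasure D μ := by
  have := isFiniteMeasure_bergmanMeasure hμ
  have hBm : MeasurableSet (polyannulus r R) := (isCompact_polyannulus r R).measurableSet
  have hrot : ∀ θ : ℝ, ∫ w in polyannulus r R,
      partialCauchy f ζ S (Function.update w k (circleMap 0 1 θ * w k)) ∂bergmanMeasure D μ =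
      ∫ w in polyannulus r R, partialCauchy f ζ S w ∂bergmanMeasure D μ := by
    intro θ
    have h := (measurePreserving_torusRotation_bergmanMeasure (μ := μ) hD
      (Function.update 1 k (Circle.exp θ))).setIntegral_preimage_emb
      (torusRotation (Function.update 1 k (Circle.exp θ))).toHomeomorph.measurableEmbedding
      (partialCauchy f ζ S) (polyannulus r R)
    rw [preimage_torusRotation_polyannulus] at h
    rw [← h]
    congr 1
    ext w
    congr 1
    ext j
    by_cases hj : j = k
    · subst hj; simp [circleMap]
    · simp [hj]
  have hint : Integrable (Function.uncurry fun (θ : ℝ) (w : Fin n → ℂ) =>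
      partialCauchy f ζ S (Function.update w k (circleMap 0 1 θ * w k)))
      ((volume.restrict (uIoc 0 (2 * Real.pi))).prod
        ((bergmanMeasure D μ).restrict (polyannulus r R))) := by
    have hc : ContinuousOn (Function.uncurry fun (θ : ℝ) (w : Fin n → ℂ) =>
        partialCauchy f ζ S (Function.update w k (circleMap 0 1 θ * w k)))
        (uIcc 0 (2 * Real.pi) ×ˢ polyannulus r R) := by
      refine (continuousOn_partialCauchy hD hB hf.continuousOn hζ S).comp
        (Continuous.continuousOn ?_) ?_
      · have := continuous_circleMap 0 1
        refine Continuous.update continuous_snd k ?_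
        fun_prop
      · rintro ⟨θ, w⟩ ⟨-, hw⟩ j
        by_cases hj : j = k
        · subst hj; simpa using hw j
        · simpa [hj] using hw j
    rw [Measure.prod_restrict]
    exact (hc.integrableOn_compact (isCompact_uIcc.prod (isCompact_polyannulus r R))).mono_set
      (prod_mono uIoc_subset_uIcc Subset.rfl)
  have hswap := intervalIntegral_integral_swap hint
  simp only [hrot] at hswap
  have hpi : (2 * Real.pi)⁻¹ • ∫ _ in (0 : ℝ)..(2 * Real.pi),
      ∫ w in polyannulus r R, partialCauchy f ζ S w ∂bergmanMeasure D μ =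
      ∫ w in polyannulus r R, partialCauchy f ζ S w ∂bergmanMeasure D μ := by
    rw [intervalIntegral.integral_const, sub_zero, smul_smul,
      inv_mul_cancel₀ (by positivity), one_smul]
  rw [← hpi, hswap, ← integral_smul]
  refine setIntegral_congr_fun hBm fun w hw => ?_
  exact circleAverage_partialCauchy hD hB hf hζ hk hw

/-- The Cauchy formula over a polyannulus: `f` at a point `ζ` inside is an average of `f` over
the polyannulus, weighted by the Cauchy kernel. -/
lemma setIntegral_mul_cauchyKernel (hD : IsBoundedLogConvexCompleteReinhardt D)
    (hμ : IsReinhardtWeight D μ)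
    (hB : polyannulus r R ⊆ D) {f : (Fin n → ℂ) → ℂ} (hf : DifferentiableOn ℂ f D)
    {ζ : Fin n → ℂ} (hζ : ∀ k, ‖ζ k‖ < r k) :
    ∫ w in polyannulus r R, f w * ∏ k, w k / (w k - ζ k) ∂bergmanMeasure D μ =
      ((bergmanMeasure D μ).real (polyannulus r R) : ℂ) * f ζ := by
  have key : ∀ S : Finset (Fin n),
      ∫ w in polyannulus r R, partialCauchy f ζ ∅ w ∂bergmanMeasure D μ =
        ∫ w in polyannulus r R, partialCauchy f ζ S w ∂bergmanMeasure D μ := by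
    intro S
    induction S using Finset.induction_on with
    | empty => rfl
    | insert k S hk ih => rw [ih, setIntegral_partialCauchy_insert hD hμ hB hf hζ hk]
  have := key Finset.univ
  simpa [partialCauchy] using this

/-- Around every point of `D` there is a polydisc surrounded by a polyannulus in `D` of positive
measure. -/
lemma exists_polyannulus (hD : IsBoundedLogConvexCompleteReinhardt D)
    (hμ : IsReinhardtWeight D μ) {ζ : Fin n → ℂ} (hζ : ζ ∈ D) :
    ∃ r R : Fin n → ℝ, (∀ k, ‖ζ k‖ < r k) ∧ polyannulus r R ⊆ D ∧
      0 < (bergmanMeasure D μ).real (polyannulus r R) := by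
  have := isFiniteMeasure_bergmanMeasure hμ
  -- Enlarging the moduli of `ζ` by `a < ε` stays in `D`; the polyannulus lies between the
  -- enlargements by `ε / 4` and `ε / 2`.
  have hmod : (fun k => (‖ζ k‖ : ℂ)) ∈ D := hD.complete ζ hζ _ fun k => by simp
  obtain ⟨ε, hε, hball⟩ := Metric.isOpen_iff.1 hD.isOpen _ hmod
  have hmem : ∀ a : ℝ, 0 ≤ a → a < ε → (fun k => ((‖ζ k‖ + a : ℝ) : ℂ)) ∈ D := by
    intro a ha haε
    refine hball ((dist_pi_lt_iff hε).2 fun k => ?_)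
    simpa [dist_eq_norm, abs_of_nonneg ha] using haε
  have hB : polyannulus (fun k => ‖ζ k‖ + ε / 4) (fun k => ‖ζ k‖ + ε / 2) ⊆ D := by
    intro w hw
    refine hD.complete _ (hmem (ε / 2) (by positivity) (by linarith)) w fun k => ?_
    rw [Complex.norm_real, Real.norm_of_nonneg (by positivity)]
    exact (hw k).2
  refine ⟨_, _, fun k => by linarith, hB, ENNReal.toReal_pos ?_ (measure_ne_top _ _)⟩
  set U : Set (Fin n → ℂ) := univ.pi fun k => {x | ‖ζ k‖ + ε / 4 < ‖x‖ ∧ ‖x‖ < ‖ζ k‖ + ε / 2}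
  have hUB : U ⊆ polyannulus (fun k => ‖ζ k‖ + ε / 4) (fun k => ‖ζ k‖ + ε / 2) :=
    fun w hw k => ⟨(hw k trivial).1.le, (hw k trivial).2.le⟩
  have hUo : IsOpen U := isOpen_set_pi finite_univ fun k _ =>
    (isOpen_lt continuous_const continuous_norm).inter
      (isOpen_lt continuous_norm continuous_const)
  have hne : U.Nonempty := by
    refine ⟨fun k => ((‖ζ k‖ + 3 * ε / 8 : ℝ) : ℂ), fun k _ => ?_⟩
    simp only [mem_ofPred_eq]
    rw [Complex.norm_real, Real.norm_of_nonneg (by positivity)]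
    constructor <;> linarith
  exact fun h0 => bergmanMeasure_ne_zero_of_isOpen hμ hUo (hUB.trans hB) hne
    (measure_mono_null hUB h0)

end Cauchy

/-! ### Point evaluations and existence of the Bergman kernel -/

section ExtendByZero

variable {X : Type*} [TopologicalSpace X] [MeasurableSpace X] [BorelSpace X]

lemma memLp_extend_zero (ν : Measure X) [IsFiniteMeasure ν] {B : Set X}
    (hB : MeasurableSet B) [CompactSpace B] (φ : C(B, ℂ)) :
    MemLp (Function.extend Subtype.val φ (0 : X → ℂ)) 2 ν := by
  refine MemLp.of_bound ((MeasurableEmbedding.subtype_coe hB).stronglyMeasurable_extend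
    φ.continuous.measurable.stronglyMeasurable
    stronglyMeasurable_zero).aestronglyMeasurable ‖φ‖ (Filter.Eventually.of_forall fun x => ?_)
  by_cases hx : x ∈ B
  · rw [Subtype.val_injective.extend_apply φ 0 ⟨x, hx⟩]
    exact φ.norm_coe_le_norm _
  · rw [Function.extend_apply' _ _ _ (by simpa using hx)]
    simp

/-- Extension by zero of a continuous function on the compact set `B`, as an element of
`L²(ν)`. -/
def extendByZero (ν : Measure X) [IsFiniteMeasure ν] {B : Set X}
    (hB : MeasurableSet B) [CompactSpace B] : C(B, ℂ) →L[ℂ] Lp ℂ 2 ν :=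
  LinearMap.mkContinuous
    { toFun := fun φ => (memLp_extend_zero ν hB φ).toLp _
      map_add' := fun φ ψ => by
        rw [← MemLp.toLp_add]
        congr 1
        rw [← Function.extend_add]
        simp
      map_smul' := fun c φ => by
        rw [RingHom.id_apply, ← MemLp.toLp_const_smul]
        congr 1
        rw [← Function.extend_smul]
        simp }
    (measureUnivNNReal ν ^ (2 : ENNReal).toReal⁻¹)
    fun φ => by
      refine Lp.norm_le_of_ae_bound (norm_nonneg _) ?_
      filter_upwards [MemLp.coeFn_toLp (memLp_extend_zero ν hB φ)] with x hx
      simp only [LinearMap.coe_mk, AddHom.coe_mk]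
      rw [hx]
      by_cases hxB : x ∈ B
      · rw [Subtype.val_injective.extend_apply φ 0 ⟨x, hxB⟩]
        exact φ.norm_coe_le_norm _
      · rw [Function.extend_apply' _ _ _ (by simpa using hxB)]
        simp

lemma coeFn_extendByZero (ν : Measure X) [IsFiniteMeasure ν] {B : Set X}
    (hB : MeasurableSet B) [CompactSpace B] (φ : C(B, ℂ)) :
    extendByZero ν hB φ =ᵐ[ν] Function.extend Subtype.val φ (0 : X → ℂ) :=
  MemLp.coeFn_toLp (memLp_extend_zero ν hB φ)

lemma inner_extendByZero (ν : Measure X) [IsFiniteMeasure ν] {B : Set X}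
    (hB : MeasurableSet B) [CompactSpace B] (φ : C(B, ℂ)) {ψ : X → ℂ} (hψ : ∀ x : B, φ x = ψ x)
    (g : Lp ℂ 2 ν) :
    inner ℂ (extendByZero ν hB φ) g = ∫ x in B, g x * starRingEnd ℂ (ψ x) ∂ν := by
  rw [L2.inner_def, ← integral_indicator hB]
  refine integral_congr_ae ?_
  filter_upwards [coeFn_extendByZero ν hB φ] with x hx
  rw [hx]
  by_cases hxB : x ∈ B
  · rw [Subtype.val_injective.extend_apply φ 0 ⟨x, hxB⟩, indicator_of_mem hxB, hψ]
    rfl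
  · rw [Function.extend_apply' _ _ _ (by simpa using hxB), indicator_of_notMem hxB]
    simp

end ExtendByZero

section Evaluation

variable {n : ℕ} {D : Set (Fin n → ℂ)} {μ : (Fin n → ℝ) → ℝ}

/-- The Cauchy kernel `w ↦ ∏ w_k / (w_k - ζ_k)` as an element of the Banach algebra of continuous
functions on `B`, written with inverses in that algebra; `a k` is the function `w ↦ 1 / w_k`. -/
def cauchyFun {B : Set (Fin n → ℂ)} [CompactSpace B] (a : Fin n → C(B, ℂ)) (ζ : Fin n → ℂ) :
    C(B, ℂ) :=
  ∏ k, Ring.inverse (1 - ζ k • a k)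

lemma contDiffAt_cauchyFun {B : Set (Fin n → ℂ)} [CompactSpace B] {a : Fin n → C(B, ℂ)}
    {ζ : Fin n → ℂ} (h : ∀ k, IsUnit (1 - ζ k • a k)) {m : WithTop ℕ∞} :
    ContDiffAt ℂ m (cauchyFun a) ζ := by
  have hc : cauchyFun a = fun ζ => ∏ k, Ring.inverse (1 - ζ k • a k) := rfl
  rw [hc]
  refine contDiffAt_prod fun k _ => ?_
  obtain ⟨u, hu⟩ := h k
  have h1 : ContDiffAt ℂ m (fun ζ : Fin n → ℂ => 1 - ζ k • a k) ζ := by fun_prop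
  exact ContDiffAt.comp ζ (g := Ring.inverse) (hu ▸ contDiffAt_ringInverse ℂ u) h1

/-- Evaluation at points near `ζ₀` is represented on the Bergman space by vectors `Φ ζ ∈ L²`, given
by the Cauchy formula, that depend smoothly and antiholomorphically on `ζ`. -/
lemma exists_evaluation_vectors (hD : IsBoundedLogConvexCompleteReinhardt D)
    (hμ : IsReinhardtWeight D μ) {ζ₀ : Fin n → ℂ} (hζ₀ : ζ₀ ∈ D) :
    ∃ V : Set (Fin n → ℂ), IsOpen V ∧ ζ₀ ∈ V ∧
      ∃ Φ : (Fin n → ℂ) → Lp ℂ 2 (bergmanMeasure D μ),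
        (∀ ζ ∈ V, ContDiffAt ℝ (⊤ : ℕ∞) Φ ζ) ∧
        (∀ g, ∀ ζ ∈ V, DifferentiableAt ℂ (fun ζ => inner ℂ (Φ ζ) g) ζ) ∧
        ∀ f, DifferentiableOn ℂ f D → ∀ g : Lp ℂ 2 (bergmanMeasure D μ),
          g =ᵐ[bergmanMeasure D μ] f → ∀ ζ ∈ V, inner ℂ (Φ ζ) g = f ζ := by
  have := isFiniteMeasure_bergmanMeasure hμ
  obtain ⟨r, R, hr, hB, hm⟩ := exists_polyannulus hD hμ hζ₀
  set B := polyannulus r R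
  set m := (bergmanMeasure D μ).real B
  have : CompactSpace B := isCompact_iff_compactSpace.1 (isCompact_polyannulus r R)
  have hBm : MeasurableSet B := (isCompact_polyannulus r R).measurableSet
  have hne : ∀ w ∈ B, ∀ k, w k ≠ 0 := fun w hw k =>
    norm_pos_iff.1 (((norm_nonneg _).trans_lt (hr k)).trans_le (hw k).1)
  set a : Fin n → C(B, ℂ) := fun k =>
    ⟨fun w => (w.1 k)⁻¹, Continuous.inv₀
      ((continuous_apply k).comp continuous_subtype_val) fun w => hne _ w.2 k⟩ with ha
  set V : Set (Fin n → ℂ) := univ.pi fun k => Metric.ball 0 (r k) with hV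
  have hVr : ∀ ζ ∈ V, ∀ k, ‖ζ k‖ < r k := fun ζ hζ k => by simpa using hζ k trivial
  have hsub : ∀ ζ ∈ V, ∀ w ∈ B, ∀ k, w k - ζ k ≠ 0 := fun ζ hζ w hw k h0 =>
    ((hVr ζ hζ k).trans_le (sub_eq_zero.1 h0 ▸ (hw k).1)).false
  have hval : ∀ ζ ∈ V, ∀ k, ∀ w : B, (1 - ζ k • a k) w = (w.1 k - ζ k) / w.1 k := by
    intro ζ hζ k w
    have := hne _ w.2 k
    simp only [ha, ContinuousMap.sub_apply, ContinuousMap.one_apply, ContinuousMap.smul_apply,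
      ContinuousMap.coe_mk, smul_eq_mul]
    field_simp
  have hunit : ∀ ζ ∈ V, ∀ k, IsUnit (1 - ζ k • a k) := by
    intro ζ hζ k
    refine ContinuousMap.isUnit_iff_forall_ne_zero _ |>.2 fun w => ?_
    rw [hval ζ hζ]
    exact div_ne_zero (hsub ζ hζ _ w.2 k) (hne _ w.2 k)
  have happ : ∀ ζ ∈ V, ∀ w : B, cauchyFun a ζ w = ∏ k, w.1 k / (w.1 k - ζ k) := by
    intro ζ hζ w
    rw [cauchyFun, ContinuousMap.prod_apply]
    refine Finset.prod_congr rfl fun k _ => ?_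
    have h1 := congrArg (fun φ : C(B, ℂ) => φ w) (Ring.mul_inverse_cancel _ (hunit ζ hζ k))
    simp only [ContinuousMap.mul_apply, ContinuousMap.one_apply, hval ζ hζ] at h1
    rw [← inv_div]
    exact (inv_eq_of_mul_eq_one_right h1).symm
  -- The inner product of `L²` is conjugate-linear on the left, hence the conjugate of the kernel.
  refine ⟨V, isOpen_set_pi finite_univ fun k _ => Metric.isOpen_ball, fun k _ => by
    simpa using hr k, fun ζ => extendByZero (bergmanMeasure D μ) hBm
      (star (((m : ℂ)⁻¹) • cauchyFun a ζ)), fun ζ hζ => ?_, fun g ζ hζ => ?_,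
      fun f hf g hg ζ hζ => ?_⟩
  · have h1 : ContDiffAt ℝ (⊤ : ℕ∞) (fun ζ => ((m : ℂ)⁻¹) • cauchyFun a ζ) ζ :=
      (((contDiffAt_cauchyFun (m := (⊤ : ℕ∞)) (hunit ζ hζ))).restrict_scalars ℝ).const_smul _
    have h2 := (starL' ℝ : C(B, ℂ) ≃L[ℝ] C(B, ℂ)).contDiff.contDiffAt.comp ζ h1
    exact (((extendByZero (bergmanMeasure D μ) hBm).restrictScalars ℝ).contDiff.contDiffAt).comp
      ζ h2
  · have h1 : DifferentiableAt ℂ (fun ζ => ((m : ℂ)⁻¹) • cauchyFun a ζ) ζ :=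
      ((contDiffAt_cauchyFun (m := 1) (hunit ζ hζ)).differentiableAt (by simp)).fun_const_smul _
    have h2 : DifferentiableAt ℂ ((innerSLFlip ℂ g).comp
      ((extendByZero (bergmanMeasure D μ) hBm).comp
        (starL ℂ : C(B, ℂ) ≃L⋆[ℂ] C(B, ℂ)).toContinuousLinearMap))
      (((m : ℂ)⁻¹) • cauchyFun a ζ) := ContinuousLinearMap.differentiableAt _
    have h3 := h2.comp ζ h1
    exact h3
  · have h1 : ∀ w : B, (star (((m : ℂ)⁻¹) • cauchyFun a ζ)) w =
        (fun w : Fin n → ℂ => starRingEnd ℂ ((m : ℂ)⁻¹ * ∏ k, w k / (w k - ζ k))) w.1 := by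
      intro w
      simp only [ContinuousMap.star_apply, ContinuousMap.smul_apply, happ ζ hζ w, smul_eq_mul]
      rfl
    have h2 : ∫ x in B, g x * starRingEnd ℂ
        (starRingEnd ℂ ((m : ℂ)⁻¹ * ∏ k, x k / (x k - ζ k))) ∂bergmanMeasure D μ =
        ∫ x in B, (m : ℂ)⁻¹ * (f x * ∏ k, x k / (x k - ζ k)) ∂bergmanMeasure D μ := by
      refine integral_congr_ae ?_
      filter_upwards [ae_restrict_of_ae hg] with x hx
      rw [Complex.conj_conj, hx]
      ring
    rw [inner_extendByZero (bergmanMeasure D μ) hBm _ (ψ := fun w => starRingEnd ℂ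
      ((m : ℂ)⁻¹ * ∏ k, w k / (w k - ζ k))) h1, h2, integral_const_mul,
      setIntegral_mul_cauchyKernel hD hμ hB hf (hVr ζ hζ), ← mul_assoc, inv_mul_cancel₀, one_mul]
    exact_mod_cast hm.ne'

end Evaluation

section BergmanSpace

variable {n : ℕ} {D : Set (Fin n → ℂ)} {μ : (Fin n → ℝ) → ℝ}

/-- The weighted Bergman space `A²_μ(D)` as a subspace of `L²`. -/
def bergmanSpace (D : Set (Fin n → ℂ)) (μ : (Fin n → ℝ) → ℝ) :
    Submodule ℂ (Lp ℂ 2 (bergmanMeasure D μ)) where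
  carrier := {g | ∃ f, DifferentiableOn ℂ f D ∧ g =ᵐ[bergmanMeasure D μ] f}
  add_mem' := by
    rintro g₁ g₂ ⟨f₁, hf₁, h₁⟩ ⟨f₂, hf₂, h₂⟩
    exact ⟨f₁ + f₂, hf₁.add hf₂, (Lp.coeFn_add g₁ g₂).trans (h₁.add h₂)⟩
  zero_mem' := ⟨0, differentiableOn_const 0, Lp.coeFn_zero ..⟩
  smul_mem' := by
    rintro c g ⟨f, hf, h⟩
    exact ⟨c • f, hf.const_smul c, (Lp.coeFn_smul c g).trans (h.const_smul c)⟩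

/-- The Bergman space is closed in `L²`: by the Cauchy formula, `L²`-convergence implies pointwise
convergence on `D`, and the limit is holomorphic because the evaluation vectors depend
antiholomorphically on the point. -/
lemma isClosed_bergmanSpace (hD : IsBoundedLogConvexCompleteReinhardt D)
    (hμ : IsReinhardtWeight D μ) :
    IsClosed (bergmanSpace D μ : Set (Lp ℂ 2 (bergmanMeasure D μ))) := by
  refine isClosed_of_closure_subset fun g hg => ?_
  obtain ⟨u, hu, hug⟩ := mem_closure_iff_seq_limit.1 hg
  choose f hf huf using hu
  choose! V hVo hV Φ _ hΦd hΦ using fun ζ (hζ : ζ ∈ D) => exists_evaluation_vectors hD hμ hζ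
  -- The values `f i ζ` converge, to the same limit whichever family of evaluation vectors is used.
  have hlim : ∀ z ∈ D, ∀ ζ ∈ V z,
      Filter.Tendsto (fun i => f i ζ) Filter.atTop (nhds (inner ℂ (Φ z ζ) g)) := by
    intro z hz ζ hζ
    have := (Filter.Tendsto.inner (𝕜 := ℂ) (tendsto_const_nhds (x := Φ z ζ)) hug)
    refine this.congr fun i => hΦ z hz (f i) (hf i) (u i) (huf i) ζ hζ
  refine ⟨fun ζ => inner ℂ (Φ ζ ζ) g, fun z hz => ?_, ?_⟩
  · refine ((hΦd z hz g z (hV z hz)).congr_of_eventuallyEq ?_).differentiableWithinAt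
    filter_upwards [(hVo z hz).mem_nhds (hV z hz), hD.isOpen.mem_nhds hz] with ζ hζ hζD
    exact tendsto_nhds_unique (hlim ζ hζD ζ (hV ζ hζD)) (hlim z hz ζ hζ)
  -- A subsequence converges to `g` almost everywhere, so `g` is the pointwise limit.
  · obtain ⟨ns, hns, hae⟩ := (tendstoInMeasure_of_tendsto_Lp hug).exists_seq_tendsto_ae
    filter_upwards [hae, ae_all_iff.2 huf, ae_mem_bergmanMeasure hD.isOpen] with z h1 h2 hz
    refine tendsto_nhds_unique h1 (((hlim z hz z (hV z hz)).comp hns.tendsto_atTop).congr ?_)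
    exact fun i => (h2 (ns i)).symm

lemma MemBergman.memLp (hD : IsOpen D) (hμ : IsReinhardtWeight D μ) {f : (Fin n → ℂ) → ℂ}
    (hf : MemBergman D μ f) : MemLp f 2 (bergmanMeasure D μ) :=
  ((memBergman_iff hD hμ f).1 hf).2

lemma toLp_mem_bergmanSpace (hD : IsOpen D) (hμ : IsReinhardtWeight D μ) {f : (Fin n → ℂ) → ℂ}
    (hf : MemBergman D μ f) : (hf.memLp hD hμ).toLp f ∈ bergmanSpace D μ :=
  ⟨f, hf.1, MemLp.coeFn_toLp _⟩

lemma exists_memBergman_of_mem (hD : IsOpen D) (hμ : IsReinhardtWeight D μ)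
    {g : Lp ℂ 2 (bergmanMeasure D μ)} (hg : g ∈ bergmanSpace D μ) :
    ∃ f, MemBergman D μ f ∧ g =ᵐ[bergmanMeasure D μ] f := by
  obtain ⟨f, hf, hgf⟩ := hg
  exact ⟨f, (memBergman_iff hD hμ f).2 ⟨hf, (memLp_congr_ae hgf).1 (Lp.memLp g)⟩, hgf⟩

lemma inner_eq_integral (hD : IsOpen D) (hμ : IsReinhardtWeight D μ)
    {g₁ g₂ : Lp ℂ 2 (bergmanMeasure D μ)} {f₁ f₂ : (Fin n → ℂ) → ℂ}
    (h₁ : g₁ =ᵐ[bergmanMeasure D μ] f₁) (h₂ : g₂ =ᵐ[bergmanMeasure D μ] f₂) :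
    inner ℂ g₁ g₂ = ∫ z in D, f₂ z * starRingEnd ℂ (f₁ z) * (μ (moduli z) : ℂ) := by
  rw [← integral_bergmanMeasure hD hμ (fun z => f₂ z * starRingEnd ℂ (f₁ z)), L2.inner_def]
  refine integral_congr_ae ?_
  filter_upwards [h₁, h₂] with z hz₁ hz₂
  rw [hz₁, hz₂]
  rfl

/-- The Bergman kernel exists: `K(·, ζ)` is the orthogonal projection of an evaluation vector to the
Bergman space. -/
lemma exists_isBergmanKernel (hD : IsBoundedLogConvexCompleteReinhardt D)
    (hμ : IsReinhardtWeight D μ) : ∃ K, IsBergmanKernel D μ K := by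
  have hcl := isClosed_bergmanSpace hD hμ
  have : CompleteSpace (bergmanSpace D μ) := hcl.completeSpace_coe
  choose! V hVo hV Φ _ hΦd hΦ using fun ζ (hζ : ζ ∈ D) => exists_evaluation_vectors hD hμ hζ
  choose k hk hkP using fun ζ => exists_memBergman_of_mem hD.isOpen hμ
    ((bergmanSpace D μ).starProjection_apply_mem (Φ ζ ζ))
  refine ⟨fun z ζ => k ζ z, fun ζ hζ => ⟨hk ζ, fun f hf => ?_⟩⟩
  rw [← inner_eq_integral hD.isOpen hμ (hkP ζ) (MemLp.coeFn_toLp (hf.memLp hD.isOpen hμ)),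
    Submodule.inner_starProjection_left_eq_right,
    Submodule.starProjection_eq_self_iff.2 (toLp_mem_bergmanSpace hD.isOpen hμ hf)]
  exact (hΦ ζ hζ f hf.1 _ (MemLp.coeFn_toLp _) ζ (hV ζ hζ)).symm

lemma isBergmanKernel_bergmanKernel (hD : IsBoundedLogConvexCompleteReinhardt D)
    (hμ : IsReinhardtWeight D μ) : IsBergmanKernel D μ (bergmanKernel D μ) := by
  have h := exists_isBergmanKernel hD hμ
  rw [bergmanKernel, dif_pos h]
  exact h.choose_spec

/-! ### Symmetry, smoothness and positivity of the Bergman kernel -/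

/-- Two reproducing kernels are conjugate-transposes of each other on `D × D`. -/
lemma IsBergmanKernel.eq_conj {K K' : (Fin n → ℂ) → (Fin n → ℂ) → ℂ}
    (hK : IsBergmanKernel D μ K) (hK' : IsBergmanKernel D μ K') {z ζ : Fin n → ℂ} (hz : z ∈ D)
    (hζ : ζ ∈ D) : K z ζ = starRingEnd ℂ (K' ζ z) := by
  rw [(hK' z hz).2 _ (hK ζ hζ).1, (hK ζ hζ).2 _ (hK' z hz).1, ← integral_conj]
  refine integral_congr_ae (Filter.Eventually.of_forall fun w => ?_)
  simp only [map_mul, Complex.conj_conj, Complex.conj_ofReal]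
  ring

lemma IsBergmanKernel.unique {K K' : (Fin n → ℂ) → (Fin n → ℂ) → ℂ}
    (hK : IsBergmanKernel D μ K) (hK' : IsBergmanKernel D μ K') {z ζ : Fin n → ℂ} (hz : z ∈ D)
    (hζ : ζ ∈ D) : K z ζ = K' z ζ := by
  rw [hK.eq_conj hK hz hζ, hK'.eq_conj hK hz hζ]

/-- The torus acts unitarily on the Bergman space, so rotating both variables gives again a
reproducing kernel. -/
lemma IsBergmanKernel.comp_torusRotation (hD : IsBoundedLogConvexCompleteReinhardt D)
    (hμ : IsReinhardtWeight D μ) {K : (Fin n → ℂ) → (Fin n → ℂ) → ℂ} (hK : IsBergmanKernel D μ K)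
    (t : Fin n → Circle) :
    IsBergmanKernel D μ fun z ζ => K (torusRotation t z) (torusRotation t ζ) := by
  have hmem : ∀ (s : Fin n → Circle) {f}, MemBergman D μ f →
      MemBergman D μ (fun z => f (torusRotation s z)) := fun s f hf => by
    rw [memBergman_iff hD.isOpen hμ] at hf ⊢
    exact ⟨hf.1.comp (differentiable_torusRotation s).differentiableOn
      fun z hz => (hD.torusRotation_mem_iff s z).2 hz,
      hf.2.comp_measurePreserving (measurePreserving_torusRotation_bergmanMeasure hD s)⟩
  have hinv : ∀ z, torusRotation t⁻¹ (torusRotation t z) = z := fun z => by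
    ext k
    simp
  intro ζ hζ
  have hζ' := (hD.torusRotation_mem_iff t ζ).2 hζ
  refine ⟨hmem t (hK _ hζ').1, fun f hf => ?_⟩
  have h1 := (hK _ hζ').2 _ (hmem t⁻¹ hf)
  rw [hinv] at h1
  rw [h1, ← integral_bergmanMeasure hD.isOpen hμ (fun z => f (torusRotation t⁻¹ z) *
      (starRingEnd ℂ) (K z (torusRotation t ζ))),
    ← integral_bergmanMeasure hD.isOpen hμ (fun z => f z * (starRingEnd ℂ)
      (K (torusRotation t z) (torusRotation t ζ))),
    ← (measurePreserving_torusRotation_bergmanMeasure (μ := μ) hD t).integral_comp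
      (torusRotation t).toHomeomorph.measurableEmbedding]
  simp only [hinv]

/-- The logarithm of the Bergman kernel on the diagonal, as a real function. -/
def bergmanPotential (D : Set (Fin n → ℂ)) (μ : (Fin n → ℝ) → ℝ) (z : Fin n → ℂ) : ℝ :=
  Real.log (bergmanKernel D μ z z).re

lemma bergmanPotential_torusRotation (hD : IsBoundedLogConvexCompleteReinhardt D)
    (hμ : IsReinhardtWeight D μ) (t : Fin n → Circle) {z : Fin n → ℂ} (hz : z ∈ D) :
    bergmanPotential D μ (torusRotation t z) = bergmanPotential D μ z := by
  have hK := isBergmanKernel_bergmanKernel hD hμ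
  rw [bergmanPotential, bergmanPotential, (hK.comp_torusRotation hD hμ t).unique hK hz hz]

/-- Locally, `K(ζ, ζ)` is the squared norm of the projection of the evaluation vector at `ζ`, hence
smooth; it is positive because constants belong to the Bergman space. -/
lemma contDiffAt_bergmanPotential (hD : IsBoundedLogConvexCompleteReinhardt D)
    (hμ : IsReinhardtWeight D μ) {z : Fin n → ℂ} (hz : z ∈ D) :
    ContDiffAt ℝ (⊤ : ℕ∞) (bergmanPotential D μ) z := by
  have hK := isBergmanKernel_bergmanKernel hD hμ
  have : CompleteSpace (bergmanSpace D μ) :=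
    (isClosed_bergmanSpace hD hμ).completeSpace_coe
  obtain ⟨V, hVo, hzV, Φ, hΦs, -, hΦ⟩ := exists_evaluation_vectors hD hμ hz
  set P := (bergmanSpace D μ).starProjection with hP
  have hproj : ∀ ζ (hζ : ζ ∈ D), ζ ∈ V → P (Φ ζ) = ((hK ζ hζ).1.memLp hD.isOpen hμ).toLp _ := by
    intro ζ hζ hζV
    refine Submodule.eq_starProjection_of_mem_of_inner_eq_zero
      (toLp_mem_bergmanSpace hD.isOpen hμ (hK ζ hζ).1) fun w hw => ?_
    obtain ⟨f, hf, hwf⟩ := exists_memBergman_of_mem hD.isOpen hμ hw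
    rw [inner_sub_left, hΦ f hf.1 w hwf ζ hζV,
      inner_eq_integral hD.isOpen hμ (MemLp.coeFn_toLp _) hwf, ← (hK ζ hζ).2 f hf, sub_self]
  have hnorm : ∀ ζ ∈ D, ζ ∈ V → (bergmanKernel D μ ζ ζ).re = ‖P (Φ ζ)‖ ^ 2 := by
    intro ζ hζ hζV
    rw [(hK ζ hζ).2 _ (hK ζ hζ).1, ← inner_eq_integral hD.isOpen hμ
      (MemLp.coeFn_toLp ((hK ζ hζ).1.memLp hD.isOpen hμ))
      (MemLp.coeFn_toLp ((hK ζ hζ).1.memLp hD.isOpen hμ)), ← hproj ζ hζ hζV,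
      inner_self_eq_norm_sq_to_K]
    norm_cast
  have hpos : ‖P (Φ z)‖ ^ 2 ≠ 0 := by
    have hone : MemBergman D μ fun _ => 1 :=
      ⟨differentiableOn_const 1, by simpa using hμ.integrable⟩
    intro h0
    have h1 := (hK z hz).2 _ hone
    rw [← inner_eq_integral hD.isOpen hμ
      (MemLp.coeFn_toLp ((hK z hz).1.memLp hD.isOpen hμ))
      (MemLp.coeFn_toLp (hone.memLp hD.isOpen hμ)), ← hproj z hz hzV,
      norm_eq_zero.1 (pow_eq_zero_iff two_ne_zero |>.1 h0), inner_zero_left] at h1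
    exact one_ne_zero h1
  have hs : ContDiffAt ℝ (⊤ : ℕ∞) (fun ζ => Real.log (‖P (Φ ζ)‖ ^ 2)) z :=
    (ContDiffAt.norm_sq ℂ ((P.restrictScalars ℝ).contDiff.contDiffAt.comp z (hΦs z hzV))).log hpos
  refine hs.congr_of_eventuallyEq ?_
  filter_upwards [hVo.mem_nhds hzV, hD.isOpen.mem_nhds hz] with ζ hζV hζ
  rw [bergmanPotential, hnorm ζ hζ hζV]

end BergmanSpace

/-! ### The Bergman metric in terms of the real Hessian of the potential -/

section Metric

variable {n : ℕ} {D : Set (Fin n → ℂ)} {μ : (Fin n → ℝ) → ℝ}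

/-- The Hermitian part `¼ (H(u, v) + H(iu, iv))` of the real Hessian `H` of a function `L` on
`ℂⁿ`. -/
def hermitianHessian (L : (Fin n → ℂ) → ℝ) (p : Fin n → ℂ) :
    (Fin n → ℂ) →L[ℝ] (Fin n → ℂ) →L[ℝ] ℝ :=
  (1 / 4 : ℝ) • (fderiv ℝ (fderiv ℝ L) p +
    ((ContinuousLinearMap.compL ℝ (Fin n → ℂ) (Fin n → ℂ) ℝ).flip
      (Complex.I • ContinuousLinearMap.id ℝ (Fin n → ℂ))).comp
      ((fderiv ℝ (fderiv ℝ L) p).comp (Complex.I • ContinuousLinearMap.id ℝ (Fin n → ℂ))))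

lemma hermitianHessian_apply (L : (Fin n → ℂ) → ℝ) (p u v : Fin n → ℂ) :
    hermitianHessian L p u v = 1 / 4 * (fderiv ℝ (fderiv ℝ L) p u v +
      fderiv ℝ (fderiv ℝ L) p (Complex.I • u) (Complex.I • v)) := rfl

lemma ContDiffAt.fderiv_top {E F : Type*} [NormedAddCommGroup E] [NormedSpace ℝ E]
    [NormedAddCommGroup F] [NormedSpace ℝ F] {L : E → F} {p : E}
    (hL : ContDiffAt ℝ (⊤ : ℕ∞) L p) : ContDiffAt ℝ (⊤ : ℕ∞) (fderiv ℝ L) p :=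
  hL.fderiv_right (m := (⊤ : ℕ∞)) (by simp)

lemma differentiableAt_hermitianHessian {L : (Fin n → ℂ) → ℝ} {p : Fin n → ℂ}
    (hL : ContDiffAt ℝ (⊤ : ℕ∞) L p) : DifferentiableAt ℝ (hermitianHessian L) p := by
  have h : DifferentiableAt ℝ (fderiv ℝ (fderiv ℝ L)) p :=
    hL.fderiv_top.fderiv_top.differentiableAt (by simp)
  have h' : DifferentiableAt ℝ (fun p => ((ContinuousLinearMap.compL ℝ (Fin n → ℂ) (Fin n → ℂ)
      ℝ).flip (Complex.I • ContinuousLinearMap.id ℝ (Fin n → ℂ))).comp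
      ((fderiv ℝ (fderiv ℝ L) p).comp (Complex.I • ContinuousLinearMap.id ℝ (Fin n → ℂ)))) p :=
    (differentiableAt_const _).clm_comp (h.clm_comp (differentiableAt_const _))
  exact (DifferentiableAt.add (𝕜 := ℝ) (E := Fin n → ℂ)
    (F := (Fin n → ℂ) →L[ℝ] (Fin n → ℂ) →L[ℝ] ℝ) h h').const_smul (1 / 4 : ℝ)

lemma hermitianHessian_comm {L : (Fin n → ℂ) → ℝ} {p : Fin n → ℂ}
    (hL : ContDiffAt ℝ (⊤ : ℕ∞) L p) (u v : Fin n → ℂ) :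
    hermitianHessian L p u v = hermitianHessian L p v u := by
  have h : IsSymmSndFDerivAt ℝ L p := hL.isSymmSndFDerivAt (by
    simpa using (mod_cast le_top : ((2 : ℕ∞) : WithTop ℕ∞) ≤ ((⊤ : ℕ∞) : WithTop ℕ∞)))
  rw [hermitianHessian_apply, hermitianHessian_apply, h.eq u v, h.eq (Complex.I • u)]

lemma hermitianHessian_torusRotation {L : (Fin n → ℂ) → ℝ}
    {t : Fin n → Circle} {p : Fin n → ℂ}
    (hL : ContDiffAt ℝ (⊤ : ℕ∞) L (torusRotation t p))
    (hinv : ∀ᶠ q in nhds p, L (torusRotation t q) = L q) (u v : Fin n → ℂ) :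
    hermitianHessian L (torusRotation t p) (torusRotation t u) (torusRotation t v) =
      hermitianHessian L p u v := by
  have h1 : fderiv ℝ L =ᶠ[nhds p] fun q =>
      (ContinuousLinearMap.compL ℝ (Fin n → ℂ) (Fin n → ℂ) ℝ).flip
        (torusRotation t : (Fin n → ℂ) →L[ℝ] (Fin n → ℂ)) (fderiv ℝ L (torusRotation t q)) := by
    filter_upwards [hinv.eventually_nhds] with q hq
    rw [← Filter.EventuallyEq.fderiv_eq (f₁ := fun q => L (torusRotation t q)) hq]
    exact (torusRotation t).comp_right_fderiv
  have h2 : ∀ u v, fderiv ℝ (fderiv ℝ L) p u v =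
      fderiv ℝ (fderiv ℝ L) (torusRotation t p) (torusRotation t u) (torusRotation t v) := by
    intro u v
    have h3 : HasFDerivAt (fderiv ℝ L) (fderiv ℝ (fderiv ℝ L) (torusRotation t p))
        (torusRotation t p) := (hL.fderiv_top.differentiableAt (by simp)).hasFDerivAt
    have h4 := ((ContinuousLinearMap.compL ℝ (Fin n → ℂ) (Fin n → ℂ) ℝ).flip
        (torusRotation t : (Fin n → ℂ) →L[ℝ] (Fin n → ℂ))).hasFDerivAt.comp p
        (h3.comp p (torusRotation t).hasFDerivAt)
    rw [h1.fderiv_eq]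
    exact congrArg (fun T => T u v) h4.fderiv
  have hI : ∀ u, torusRotation t (Complex.I • u) = Complex.I • torusRotation t u := by
    intro u
    ext k
    simp only [torusRotation_apply, Pi.smul_apply, smul_eq_mul]
    ring
  rw [hermitianHessian_apply, hermitianHessian_apply, h2 u v, h2 (Complex.I • u), hI, hI]

/-- Expansion of a real-linear form in the real basis `e_k`, `i e_k` of `ℂⁿ`. -/
lemma clm_apply_eq_sum (B : (Fin n → ℂ) →L[ℝ] ℝ) (u : Fin n → ℂ) :
    B u = ∑ k, ((u k).re * B (Pi.single k 1) + (u k).im * B (Pi.single k Complex.I)) := by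
  have h : u = ∑ k, ((u k).re • (Pi.single k 1 : Fin n → ℂ) +
      (u k).im • (Pi.single k Complex.I : Fin n → ℂ)) := by
    ext j
    simp [Finset.sum_apply, Pi.single_apply, Finset.sum_add_distrib]
  conv_lhs => rw [h]
  simp

lemma bilin_apply_eq_sum (B : (Fin n → ℂ) →L[ℝ] (Fin n → ℂ) →L[ℝ] ℝ) (u v : Fin n → ℂ) :
    B u v = ∑ k, ∑ l,
      ((u k).re * ((v l).re * B (Pi.single k 1) (Pi.single l 1) +
          (v l).im * B (Pi.single k 1) (Pi.single l Complex.I)) +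
        (u k).im * ((v l).re * B (Pi.single k Complex.I) (Pi.single l 1) +
          (v l).im * B (Pi.single k Complex.I) (Pi.single l Complex.I))) := by
  have h := clm_apply_eq_sum (B.flip v) u
  simp only [ContinuousLinearMap.flip_apply] at h
  rw [h]
  refine Finset.sum_congr rfl fun k _ => ?_
  rw [clm_apply_eq_sum (B (Pi.single k 1)) v, clm_apply_eq_sum (B (Pi.single k Complex.I)) v,
    Finset.mul_sum, Finset.mul_sum, ← Finset.sum_add_distrib]

/-- For real `L`, `∂_k ∂̄_l L` in terms of the real Hessian `H` of `L`: it is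
`¼ (H(e_k, e_l) + H(ie_k, ie_l) + i (H(e_k, ie_l) - H(ie_k, e_l)))`. -/
lemma wirtinger_wirtingerBar_ofReal {L : (Fin n → ℂ) → ℝ} {p : Fin n → ℂ}
    (hL : ContDiffAt ℝ (⊤ : ℕ∞) L p) (k l : Fin n) :
    wirtinger k (wirtingerBar l fun z => (L z : ℂ)) p =
      (1 / 4 : ℂ) * ((fderiv ℝ (fderiv ℝ L) p (Pi.single k 1) (Pi.single l 1) +
        Complex.I * fderiv ℝ (fderiv ℝ L) p (Pi.single k 1) (Pi.single l Complex.I)) -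
        Complex.I * (fderiv ℝ (fderiv ℝ L) p (Pi.single k Complex.I) (Pi.single l 1) +
        Complex.I *
          fderiv ℝ (fderiv ℝ L) p (Pi.single k Complex.I) (Pi.single l Complex.I))) := by
  set Λ : ((Fin n → ℂ) →L[ℝ] ℝ) →L[ℝ] ℂ := (1 / 2 : ℂ) •
    (Complex.ofRealCLM.comp (ContinuousLinearMap.apply ℝ ℝ (Pi.single l 1)) +
      Complex.I • Complex.ofRealCLM.comp
        (ContinuousLinearMap.apply ℝ ℝ (Pi.single l Complex.I))) with hΛ
  have h1 : (wirtingerBar l fun z => (L z : ℂ)) =ᶠ[nhds p] fun q => Λ (fderiv ℝ L q) := by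
    filter_upwards [(hL.of_le (m := 1) (by simp)).eventually (by simp)] with q hq
    have h2 : HasFDerivAt (fun z => (L z : ℂ)) (Complex.ofRealCLM.comp (fderiv ℝ L q)) q :=
      Complex.ofRealCLM.hasFDerivAt.comp q (hq.differentiableAt (by simp)).hasFDerivAt
    rw [wirtingerBar, h2.fderiv]
    rfl
  have h3 : HasFDerivAt (fun q => Λ (fderiv ℝ L q)) (Λ.comp (fderiv ℝ (fderiv ℝ L) p)) p :=
    Λ.hasFDerivAt.comp p (hL.fderiv_top.differentiableAt (by simp)).hasFDerivAt
  rw [wirtinger, h1.fderiv_eq, h3.fderiv]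
  simp only [hΛ, ContinuousLinearMap.comp_apply, smul_apply,
    add_apply, ContinuousLinearMap.apply_apply, Complex.ofRealCLM_apply,
    smul_eq_mul]
  ring

/-- Since the potential is real, the real part of `∑ ∂_k ∂̄_l log K · u_k v̄_l` is the Hermitian part
of its real Hessian. -/
lemma bergmanRiemannian_eq_hermitianHessian {p : Fin n → ℂ}
    (hL : ContDiffAt ℝ (⊤ : ℕ∞) (bergmanPotential D μ) p) (u v : Fin n → ℂ) :
    bergmanRiemannian D μ p u v = hermitianHessian (bergmanPotential D μ) p u v := by
  rw [bergmanRiemannian, bergmanHermitian, hermitianHessian_apply, bilin_apply_eq_sum _ u v,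
    bilin_apply_eq_sum _ (Complex.I • u), ← Finset.sum_add_distrib, Finset.mul_sum,
    Complex.re_sum]
  refine Finset.sum_congr rfl fun k _ => ?_
  rw [← Finset.sum_add_distrib, Finset.mul_sum, Complex.re_sum]
  refine Finset.sum_congr rfl fun l _ => ?_
  have h : logBergmanDiag D μ = fun z => (bergmanPotential D μ z : ℂ) := rfl
  rw [h, wirtinger_wirtingerBar_ofReal hL]
  generalize fderiv ℝ (fderiv ℝ (bergmanPotential D μ)) p = H
  rw [show (1 / 4 : ℂ) = ((1 / 4 : ℝ) : ℂ) by norm_num]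
  simp only [Complex.mul_re, Complex.mul_im, Complex.add_re, Complex.add_im, Complex.sub_re,
    Complex.sub_im, Complex.ofReal_re, Complex.ofReal_im, Complex.I_re, Complex.I_im,
    Complex.conj_re, Complex.conj_im, Pi.smul_apply, smul_eq_mul]
  ring

end Metric

/-! ### Conservation laws for geodesics -/

section Noether

variable {E : Type*} [NormedAddCommGroup E] [NormedSpace ℝ E]

/-- Noether's theorem for a linear Killing field `p ↦ A p`, the invariance of the metric `M` being
stated infinitesimally: along a geodesic the product of the velocity with the field is constant. -/
lemma IsGeodesicOn.hasDerivAt_killing {h : E → E → E → ℝ} {U : Set E} {γ : ℝ → E} {I : Set ℝ}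
    (hγ : IsGeodesicOn h U γ I) {M : E → E →L[ℝ] E →L[ℝ] ℝ}
    (hM : ∀ p ∈ U, DifferentiableAt ℝ M p)
    (hh : ∀ p ∈ U, ∀ᶠ q in nhds p, ∀ u v, h q u v = M q u v)
    (hsymm : ∀ p ∈ U, ∀ u v, M p u v = M p v u) (A : E →L[ℝ] E)
    (hA : ∀ p ∈ U, ∀ u v, fderiv ℝ M p (A p) u v + M p (A u) v + M p u (A v) = 0)
    {t : ℝ} (ht : t ∈ I) :
    HasDerivAt (fun s => M (γ s) (deriv γ s) (A (γ s))) 0 t := by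
  have hp := hγ.mapsTo ht
  have hC : ContDiffAt ℝ 2 γ t := hγ.contDiffOn.contDiffAt (hγ.isOpen.mem_nhds ht)
  have h1 : HasDerivAt γ (deriv γ t) t := (hC.differentiableAt (by simp)).hasDerivAt
  have h2 : HasDerivAt (deriv γ) (deriv (deriv γ) t) t := by
    have : ContDiffOn ℝ 1 (deriv γ) I :=
      ((contDiffOn_succ_iff_deriv_of_isOpen (n := 1) hγ.isOpen).1 hγ.contDiffOn).2.2
    exact ((this.contDiffAt (hγ.isOpen.mem_nhds ht)).differentiableAt (by simp)).hasDerivAt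
  have h3 : HasDerivAt (fun s => M (γ s)) (fderiv ℝ M (γ t) (deriv γ t)) t :=
    HasFDerivAt.comp_hasDerivAt (l := M) (l' := fderiv ℝ M (γ t)) t (hM _ hp).hasFDerivAt h1
  have h4 : HasDerivAt (fun s => A (γ s)) (A (deriv γ t)) t := A.hasFDerivAt.comp_hasDerivAt t h1
  have h5 := (h3.clm_apply h2).clm_apply h4
  have hfd : ∀ u v w, fderiv ℝ (fun q => h q v w) (γ t) u = fderiv ℝ M (γ t) u v w := by
    intro u v w
    have he : (fun q => h q v w) =ᶠ[nhds (γ t)] fun q => M q v w :=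
      (hh _ hp).mono fun q hq => hq v w
    have hd := ((hM _ hp).hasFDerivAt.clm_apply (hasFDerivAt_const v (γ t))).clm_apply
      (hasFDerivAt_const w (γ t))
    rw [he.fderiv_eq, hd.fderiv]
    simp
  -- The geodesic equation, tested against the field, leaves `½ (∂_A M)(γ', γ') + M(γ', Aγ')`, which
  -- vanishes by the Killing equation and symmetry.
  have hgeo := hγ.geodesicEq t ht (A (γ t))
  rw [christoffelForm, hfd, hfd, (hh _ hp).self_of_nhds] at hgeo
  have hkill := hA _ hp (deriv γ t) (deriv γ t)
  rw [hsymm _ hp (A (deriv γ t))] at hkill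
  refine h5.congr_deriv ?_
  simp only [add_apply]
  linarith

end Noether

/-! ### Torus orbits and their velocity fields -/

section Torus

variable {n : ℕ}

/-- The one-parameter group `s ↦ (e^{isθ_1}, …, e^{isθ_n})` of the torus. -/
def torusFlow (θ : Fin n → ℝ) (s : ℝ) : Fin n → Circle := fun k => Circle.exp (s * θ k)

/-- The velocity field `z ↦ (iθ_1 z_1, …, iθ_n z_n)` of the action of `torusFlow θ`. -/
def torusField (θ : Fin n → ℝ) : (Fin n → ℂ) →L[ℝ] (Fin n → ℂ) :=
  ContinuousLinearMap.pi fun k =>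
    (Complex.I * θ k : ℂ) • ContinuousLinearMap.proj (R := ℝ) (φ := fun _ : Fin n => ℂ) k

lemma torusRotation_torusFlow_zero (θ : Fin n → ℝ) (z : Fin n → ℂ) :
    torusRotation (torusFlow θ 0) z = z := by
  ext k
  simp [torusFlow]

lemma hasDerivAt_torusRotation_torusFlow (θ : Fin n → ℝ) (z : Fin n → ℂ) :
    HasDerivAt (fun s => torusRotation (torusFlow θ s) z) (torusField θ z) 0 := by
  refine hasDerivAt_pi.2 fun k => ?_
  have h1 : HasDerivAt (fun s : ℝ => ((s * θ k : ℝ) : ℂ) * Complex.I) (θ k * Complex.I) 0 := by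
    simpa using (((hasDerivAt_id (0 : ℝ)).mul_const (θ k)).ofReal_comp).mul_const Complex.I
  have h2 := h1.cexp.mul_const (z k)
  simp only [torusRotation_apply, torusFlow, Circle.coe_exp]
  refine h2.congr_deriv ?_
  simp [torusField, mul_comm]

/-- A form invariant under the torus satisfies the infinitesimal Killing equation. -/
lemma killing_of_torus_invariant {M : (Fin n → ℂ) → (Fin n → ℂ) →L[ℝ] (Fin n → ℂ) →L[ℝ] ℝ}
    {p : Fin n → ℂ} (hM : DifferentiableAt ℝ M p)
    (hinv : ∀ t u v, M (torusRotation t p) (torusRotation t u) (torusRotation t v) = M p u v)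
    (θ : Fin n → ℝ) (u v : Fin n → ℂ) :
    fderiv ℝ M p (torusField θ p) u v + M p (torusField θ u) v + M p u (torusField θ v) = 0 := by
  have hM' : HasFDerivAt M (fderiv ℝ M p) (torusRotation (torusFlow θ 0) p) := by
    rw [torusRotation_torusFlow_zero]
    exact hM.hasFDerivAt
  have h0 : HasDerivAt (fun s => M (torusRotation (torusFlow θ s) p))
      (fderiv ℝ M p (torusField θ p)) 0 :=
    HasFDerivAt.comp_hasDerivAt (l := M) (l' := fderiv ℝ M p) 0 hM'
      (hasDerivAt_torusRotation_torusFlow θ p)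
  have h1 := (h0.clm_apply (hasDerivAt_torusRotation_torusFlow θ u)).clm_apply
    (hasDerivAt_torusRotation_torusFlow θ v)
  simp only [torusRotation_torusFlow_zero, hinv] at h1
  exact h1.unique (hasDerivAt_const (0 : ℝ) (M p u v))

lemma torusRotation_mem_torusOrbit {z p : Fin n → ℂ} (hp : p ∈ torusOrbit z) (t : Fin n → Circle) :
    torusRotation t p ∈ torusOrbit z := by
  obtain ⟨s, rfl⟩ := hp
  refine ⟨t * s, funext fun k => ?_⟩
  simp [mul_assoc]

lemma torusField_mem_tangentVectorsAt {z p : Fin n → ℂ} (hp : p ∈ torusOrbit z) (θ : Fin n → ℝ) :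
    torusField θ p ∈ tangentVectorsAt (torusOrbit z) p :=
  ⟨fun s => torusRotation (torusFlow θ s) p, fun _ => torusRotation_mem_torusOrbit hp _,
    torusRotation_torusFlow_zero θ p, hasDerivAt_torusRotation_torusFlow θ p⟩

/-- Where no coordinate vanishes, the vectors tangent to a torus orbit are values of the fields
`torusField θ`: along a curve in the orbit each `|z_k|` is constant, so `z_k'` is orthogonal to
`z_k`. -/
lemma exists_eq_torusField {z p v : Fin n → ℂ} (hp : ∀ k, p k ≠ 0)
    (hv : v ∈ tangentVectorsAt (torusOrbit z) p) : ∃ θ, v = torusField θ p := by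
  obtain ⟨c, hc, rfl, hd⟩ := hv
  refine ⟨fun k => (v k / c 0 k).im, funext fun k => ?_⟩
  have h1 : HasDerivAt (fun s => c s k) (v k) 0 := hasDerivAt_pi.1 hd k
  have hconst : (fun s => ‖c s k‖ ^ 2) = fun _ => ‖z k‖ ^ 2 := by
    ext s
    obtain ⟨t, ht⟩ := hc s
    rw [ht, norm_mul, Circle.norm_coe, one_mul]
  have h2 := h1.norm_sq
  rw [hconst] at h2
  have h3 : inner ℝ (c 0 k) (v k) = 0 := by
    have := h2.unique (hasDerivAt_const (0 : ℝ) (‖z k‖ ^ 2))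
    linarith
  have h4 : (v k / c 0 k).re = 0 := by
    rw [Complex.inner] at h3
    rw [Complex.div_re, ← add_div]
    simp only [Complex.mul_re, Complex.conj_re, Complex.conj_im] at h3
    rw [div_eq_zero_iff]
    left
    linarith
  have h5 : v k / c 0 k = Complex.I * ((v k / c 0 k).im : ℂ) := by
    apply Complex.ext <;> simp [h4]
  have h6 : v k = v k / c 0 k * c 0 k := (div_mul_cancel₀ _ (hp k)).symm
  rw [h5] at h6
  exact h6

end Torus

end

/-! ### Perpendicularity to torus orbits -/

theorem mainTheorem6 {n : ℕ} (D : Set (Fin n → ℂ)) (hD : IsBoundedLogConvexCompleteReinhardt D)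
    (μ : (Fin n → ℝ) → ℝ) (hμ : IsReinhardtWeight D μ)
    (I : Set ℝ) (γ : ℝ → Fin n → ℂ)
    (hγ : IsGeodesicOn (bergmanRiemannian D μ) (hatDomain D) γ I)
    (hperp : ∃ t₀ ∈ I, ∃ z ∈ hatDomain D,
      MeetsPerpendicularlyAt (bergmanRiemannian D μ) γ (torusOrbit z) t₀) :
    ∀ w ∈ hatDomain D, ∀ t ∈ I, γ t ∈ torusOrbit w →
      MeetsPerpendicularlyAt (bergmanRiemannian D μ) γ (torusOrbit w) t := by
  obtain ⟨t₀, ht₀, z, -, hz, hperp⟩ := hperp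
  intro w _ t ht hw
  refine ⟨hw, fun v hv => ?_⟩
  obtain ⟨θ, rfl⟩ := exists_eq_torusField (hγ.mapsTo ht).2 hv
  set M := hermitianHessian (bergmanPotential D μ)
  have hL : ∀ p ∈ D, ContDiffAt ℝ (⊤ : ℕ∞) (bergmanPotential D μ) p :=
    fun p hp => contDiffAt_bergmanPotential hD hμ hp
  have hhM : ∀ p ∈ D, ∀ u v, bergmanRiemannian D μ p u v = M p u v :=
    fun p hp => bergmanRiemannian_eq_hermitianHessian (hL p hp)
  have hMd : ∀ p ∈ D, DifferentiableAt ℝ M p := fun p hp =>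
    differentiableAt_hermitianHessian (hL p hp)
  have hinv : ∀ p ∈ D, ∀ t u v,
      M (torusRotation t p) (torusRotation t u) (torusRotation t v) = M p u v := by
    intro p hp t u v
    refine hermitianHessian_torusRotation (hL _ ((hD.torusRotation_mem_iff t p).2 hp)) ?_ u v
    filter_upwards [hD.isOpen.mem_nhds hp] with q hq
    exact bergmanPotential_torusRotation hD hμ t hq
  have hderiv : ∀ s ∈ I,
      HasDerivAt (fun s => M (γ s) (deriv γ s) (torusField θ (γ s))) 0 s := fun s hs =>
    hγ.hasDerivAt_killing (fun p hp => hMd p hp.1)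
      (fun p hp => Filter.eventually_of_mem (hD.isOpen.mem_nhds hp.1) hhM)
      (fun p hp => hermitianHessian_comm (hL p hp.1)) (torusField θ)
      (fun p hp => killing_of_torus_invariant (hMd p hp.1) (hinv p hp.1) θ) hs
  have hconst := hγ.isOpen.is_const_of_deriv_eq_zero hγ.ordConnected.isPreconnected
    (fun s hs => (hderiv s hs).differentiableAt.differentiableWithinAt)
    (fun s hs => (hderiv s hs).deriv) ht ht₀
  rw [hhM _ (hγ.mapsTo ht).1, hconst, ← hhM _ (hγ.mapsTo ht₀).1]
  exact hperp _ (torusField_mem_tangentVectorsAt hz θ)
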